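/- Let $A\in\mathbb R^{n\times n}$, $B\in\mathbb R^{n\times m}$, $C\in\mathbb R^{p\times n}$ and $G(z)=C(zI-A)^{-1}B$; let $G^\sim(z):=G(\bar z^{-1})^*$ be the conjugate system ($*$ is the conjugate transpose) and $\mathrm j=\sqrt{-1}$. Put $$A_h=\begin{bmatrix}A&0\\ C^TC&I\end{bmatrix},\quad E_h=\begin{bmatrix}I&0\\0&A^T\end{bmatrix},\quad B_h=\begin{bmatrix}B\\0\end{bmatrix},\quad C_h=\begin{bmatrix}0&-B^T\end{bmatrix},$$ $$\Gamma_d(\theta)=(E_h+A_h)\tan(\theta/2)-\mathrm j\,(E_h-A_h).$$ Let $\theta_1,\theta_2\in(-\pi,\pi)$ (in either order), and let $[a,b]$ denote the closed interval with end points $a$ and $b$, also when $a>b$. For $\phi\in\mathbb R$ let $\mathrm{wrap}(\phi)\in(-\pi,\pi]$ be the principal argument of $e^{\mathrm j\phi}$. Suppose that $e^{\mathrm j\phi}$ is not an eigenvalue of $A$ for any $\phi\in\mathbb R$ with $\mathrm{wrap}(\phi)\in[\theta_1,\theta_2]\cup[-\theta_1,-\theta_2]$. Then every entry of $G^\sim(e^{\mathrm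 j\theta})G(e^{\mathrm j\theta})$ is integrable on $[\theta_1,\theta_2]$; the matrix $\Gamma_d(\theta_1)$ is invertible; $\Gamma_d(\theta_1)^{-1}\Gamma_d(\theta_2)$ has no eigenvalue in $(-\infty,0]$, and it has a unique principal logarithm, that is, a unique logarithm all of whose eigenvalues lie in the strip $-\pi<\operatorname{Im}z<\pi$; and, with $\log$ denoting the principal logarithm, $$\int_{\theta_1}^{\theta_2}G^\sim(e^{\mathrm j\theta})\,G(e^{\mathrm j\theta})\,d\theta=\frac1{\mathrm j}\,C_h\log\!\left(\Gamma_d(\theta_1)^{-1}\Gamma_d(\theta_2)\right)B_h .$$ -/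

import Mathlib

noncomputable section

namespace FreqTrunc

variable {n m p : Type*} [Fintype n] [DecidableEq n]

/-- `wrap θ` is the principal argument, in `(-π, π]`, of `e^{jθ}`. -/
def wrap (θ : ℝ) : ℝ := Complex.arg (Complex.exp (θ * Complex.I))

/-- A real matrix regarded as a complex matrix. -/
def toC {k l : Type*} (M : Matrix k l ℝ) : Matrix k l ℂ := M.map Complex.ofReal

/-- The transfer function `G(z) = C (z I - A)⁻¹ B` of a strictly proper real state-space system. -/
def transfer (A : Matrix n n ℝ) (B : Matrix n m ℝ) (C : Matrix p n ℝ) (z : ℂ) : Matrix p m ℂ :=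
  toC C * (z • (1 : Matrix n n ℂ) - toC A)⁻¹ * toC B

/-- The conjugate system `G^∼(z) = (G(z̄⁻¹))*`. -/
def conjSystem (G : ℂ → Matrix p m ℂ) (z : ℂ) : Matrix m p ℂ :=
  (G ((starRingEnd ℂ) z)⁻¹).conjTranspose

/-- `Q` is a principal logarithm of `X`: it is a logarithm of `X`, and all its eigenvalues lie in
the open strip `-π < Im z < π`. -/
def IsPrincipalLog (X Q : Matrix n n ℂ) : Prop :=
  NormedSpace.exp Q = X ∧ ∀ μ ∈ spectrum ℂ Q, -Real.pi < μ.im ∧ μ.im < Real.pi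

open Classical in
/-- The principal matrix logarithm (the value `0` where there is no principal logarithm). -/
def principalLog (X : Matrix n n ℂ) : Matrix n n ℂ :=
  if h : ∃ Q, IsPrincipalLog X Q then h.choose else 0

/-- `A_h = [A, 0; Cᵀ C, I]`. -/
def augA [Fintype p] (A : Matrix n n ℝ) (C : Matrix p n ℝ) : Matrix (n ⊕ n) (n ⊕ n) ℝ :=
  Matrix.fromBlocks A 0 (C.transpose * C) 1

/-- `E_h = [I, 0; 0, Aᵀ]`. -/
def augE (A : Matrix n n ℝ) : Matrix (n ⊕ n) (n ⊕ n) ℝ :=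
  Matrix.fromBlocks 1 0 0 A.transpose

/-- `B_h = [B; 0]`. -/
def augB (B : Matrix n m ℝ) : Matrix (n ⊕ n) m ℝ := Matrix.fromRows B 0

/-- `C_h = [0, -Bᵀ]`. -/
def augC (B : Matrix n m ℝ) : Matrix m (n ⊕ n) ℝ := Matrix.fromCols 0 (-B.transpose)

/-- `Γ_d(θ) = (E_h + A_h) tan(θ/2) - j (E_h - A_h)`. -/
def Gam [Fintype p] (A : Matrix n n ℝ) (C : Matrix p n ℝ) (θ : ℝ) : Matrix (n ⊕ n) (n ⊕ n) ℂ :=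
  (Real.tan (θ / 2) : ℂ) • (toC (augE A) + toC (augA A C))
    - Complex.I • (toC (augE A) - toC (augA A C))

/-- The integral of a matrix-valued function from `a` to `b`, taken entry by entry. -/
def matInt {k l : Type*} (F : ℝ → Matrix k l ℂ) (a b : ℝ) : Matrix k l ℂ :=
  Matrix.of fun i j => ∫ θ in a..b, F θ i j

end FreqTrunc

end

noncomputable section

namespace FreqTrunc

/-! With `t = tan (θ/2)` and `z = e^{jθ}`, the matrix `Γ_d` is affine in `t` with slope `M = E_h +
A_h`, and it equals `-(t + j)(z E_h - A_h)`. Inverting this block triangular pencil gives `C_h Γ_d⁻¹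
M B_h = (2j / (1 + t²)) G^∼ G` (`augC_mul_inv_Gam_mul_augB`). Since `dθ = 2 dt / (1 + t²)`, the
integral is `(1/j) C_h (∫ Γ_d⁻¹ M dt) B_h`.

Writing `Γ_d(θ₁)⁻¹ Γ_d(θ₂) = 1 + N`, the segment `1 + s N` is `Γ_d(θ₁)⁻¹ Γ_d` at the angle whose `t`
is the matching point between `t₁` and `t₂`. It is invertible throughout, so `∫₀¹ (1 + s N)⁻¹ N ds`
is defined; this is the `t`-integral, and it is a principal logarithm of `1 + N`
(`isPrincipalLog_logPath`). Any other one commutes with it, and commuting principal logarithms agree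
(`IsPrincipalLog.eq_of_commute`). -/

/-- The exponential of a normed ring, in the topology of the norm. -/
def normExp {𝔸 : Type*} [NormedRing 𝔸] (x : 𝔸) : 𝔸 := NormedSpace.exp x

@[simp] theorem normExp_zero {𝔸 : Type*} [NormedRing 𝔸] : normExp (0 : 𝔸) = 1 :=
  NormedSpace.exp_zero

theorem commute_inverse {R : Type*} [Ring R] {T S : R} (h : Commute T S) :
    Commute T (Ring.inverse S) := by
  by_cases hS : IsUnit S
  · obtain ⟨u, rfl⟩ := hS
    rw [Ring.inverse_unit]
    exact h.units_inv_right
  · rw [Ring.inverse_non_unit _ hS]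
    exact Commute.zero_right T

/-! ### The logarithm as an integral in a Banach algebra. -/

section Banach

variable {𝔸 : Type*} [NormedRing 𝔸] [NormedAlgebra ℂ 𝔸]

theorem mul_normExp_of_mul_sq_eq_zero [CompleteSpace 𝔸] {P D : 𝔸} (h : P * D ^ 2 = 0) :
    P * normExp D = P + P * D := by
  have hs := (NormedSpace.exp_series_hasSum_exp' (𝕂 := ℂ) D).mul_left P
  have hs' : HasSum (fun k : ℕ => P * (((k.factorial : ℂ)⁻¹) • D ^ k))
      (∑ k ∈ Finset.range 2, P * (((k.factorial : ℂ)⁻¹) • D ^ k)) := by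
    refine hasSum_sum_of_ne_finset_zero fun k hk => ?_
    obtain ⟨j, rfl⟩ := Nat.exists_eq_add_of_le (not_lt.1 (by simpa using hk) : 2 ≤ k)
    rw [mul_smul_comm, pow_add, ← mul_assoc, h, zero_mul, smul_zero]
  rw [normExp, hs.unique hs']
  simp [Finset.sum_range_succ]

/-- If `D ^ (k + 2) = 0`, multiplying `exp D = 1` by `D ^ k` leaves only the linear term and gives
`D ^ (k + 1) = 0`; descend on `k`. -/
theorem eq_zero_of_isNilpotent_of_normExp_eq_one [CompleteSpace 𝔸] {D : 𝔸} (hD : IsNilpotent D)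
    (h : normExp D = 1) : D = 0 := by
  obtain ⟨k, hk⟩ := hD
  have key : ∀ k : ℕ, D ^ (k + 1) = 0 → D = 0 := by
    intro k
    induction k with
    | zero => intro h; simpa using h
    | succ k ih =>
      intro hk
      apply ih
      have := mul_normExp_of_mul_sq_eq_zero (P := D ^ k) (D := D) (by rw [← pow_add]; exact hk)
      rw [h, mul_one] at this
      rw [pow_succ]
      simpa using this
  exact key k (by rw [pow_succ, hk, zero_mul])

theorem normExp_add [CompleteSpace 𝔸] {x y : 𝔸} (h : Commute x y) :
    normExp (x + y) = normExp x * normExp y := by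
  let _ : NormedAlgebra ℚ 𝔸 := NormedAlgebra.restrictScalars ℚ ℂ 𝔸
  exact NormedSpace.exp_add_of_commute h

theorem exp_mem_spectrum_normExp [CompleteSpace 𝔸] {x : 𝔸} {μ : ℂ} (h : μ ∈ spectrum ℂ x) :
    Complex.exp μ ∈ spectrum ℂ (normExp x) := by
  rw [Complex.exp_eq_exp_ℂ]
  exact spectrum.exp_mem_exp x h

theorem commute_intervalIntegral [CompleteSpace 𝔸] {T : 𝔸} {f : ℝ → 𝔸} {a b : ℝ}
    (h : ∀ s, Commute T (f s)) : Commute T (∫ s in a..b, f s) := by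
  by_cases hf : IntervalIntegrable f MeasureTheory.volume a b
  · have h1 := (ContinuousLinearMap.mul ℝ (𝔸) T).intervalIntegral_comp_comm hf
    have h2 := ((ContinuousLinearMap.mul ℝ (𝔸)).flip T).intervalIntegral_comp_comm hf
    simp only [ContinuousLinearMap.mul_apply', ContinuousLinearMap.flip_apply] at h1 h2
    rw [Commute, SemiconjBy, ← h1, ← h2]
    exact intervalIntegral.integral_congr fun s _ => (h s).eq
  · rw [intervalIntegral.integral_undef hf]
    exact Commute.zero_right T

/-- The integrand of the integral representation of `log (1 + N)`. -/
def logKernel (N : 𝔸) (s : ℝ) : 𝔸 := Ring.inverse (1 + (s : ℂ) • N) * N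

/-- The primitive of `logKernel`. -/
def logPath (N : 𝔸) (s : ℝ) : 𝔸 := ∫ u in (0 : ℝ)..s, logKernel N u

theorem commute_logKernel {T N : 𝔸} (h : Commute T N) (s : ℝ) :
    Commute T (logKernel N s) :=
  (commute_inverse ((Commute.one_right T).add_right (h.smul_right _))).mul_right h

theorem commute_logPath [CompleteSpace 𝔸] {T N : 𝔸} (h : Commute T N) (s : ℝ) :
    Commute T (logPath N s) :=
  commute_intervalIntegral (commute_logKernel h)

variable [CompleteSpace 𝔸]

theorem continuousAt_logKernel {N : 𝔸} {s : ℝ} (h : IsUnit (1 + (s : ℂ) • N)) :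
    ContinuousAt (logKernel N) s := by
  have h1 : ContinuousAt (fun s : ℝ => 1 + (s : ℂ) • N) s := by fun_prop
  obtain ⟨u, hu⟩ := h
  have h2 : ContinuousAt Ring.inverse (1 + (s : ℂ) • N) := hu ▸ NormedRing.inverse_continuousAt u
  exact (ContinuousAt.comp (f := fun s : ℝ => 1 + (s : ℂ) • N) h2 h1).mul continuousAt_const

theorem isOpen_isUnit_one_add (N : 𝔸) : IsOpen {s : ℝ | IsUnit (1 + (s : ℂ) • N)} :=
  Units.isOpen.preimage (f := fun s : ℝ => 1 + (s : ℂ) • N) (by fun_prop)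

/-- Invertibility is an open condition, so the derivative is two-sided even at `0` and `1`. -/
theorem hasDerivAt_logPath {N : 𝔸}
    (h : ∀ s ∈ Set.Icc (0 : ℝ) 1, IsUnit (1 + (s : ℂ) • N)) {s : ℝ} (hs : s ∈ Set.Icc (0 : ℝ) 1) :
    HasDerivAt (logPath N) (logKernel N s) s := by
  refine intervalIntegral.integral_hasDerivAt_right ?_ ?_ (continuousAt_logKernel (h s hs))
  · refine ContinuousOn.intervalIntegrable fun u hu => ?_
    rw [Set.uIcc_of_le hs.1] at hu
    exact (continuousAt_logKernel (h u ⟨hu.1, hu.2.trans hs.2⟩)).continuousWithinAt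
  · exact ContinuousOn.stronglyMeasurableAtFilter (isOpen_isUnit_one_add N)
      (fun u hu => (continuousAt_logKernel hu).continuousWithinAt) s (h s hs)

/-- Commutation lets `exp (F s)` be factored out, which leaves the derivative of `exp` at `0`, the
identity. -/
theorem hasDerivAt_normExp_of_commute {F : ℝ → 𝔸} {F' : 𝔸} {s : ℝ}
    (hF : HasDerivAt F F' s) (hc : ∀ u, Commute (F s) (F u)) :
    HasDerivAt (fun u => normExp (F u)) (normExp (F s) * F') s := by
  have h0 : HasFDerivAt (normExp : 𝔸 → 𝔸)
      (1 : 𝔸 →L[ℝ] 𝔸) (F s - F s) := by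
    rw [sub_self]; exact hasFDerivAt_exp_zero
  have h1 := (h0.comp_hasDerivAt s (hF.sub_const (F s))).const_mul (normExp (F s))
  refine h1.congr_of_eventuallyEq (Filter.Eventually.of_forall fun u => ?_)
  have : Commute (F s) (F u - F s) := (hc u).sub_right (Commute.refl _)
  simp only [Function.comp_apply]
  rw [← normExp_add this, add_sub_cancel]

/-- The product `exp (-L s) (1 + s N)`, with `L = logPath N`, has derivative zero and equals `1` at
`s = 0`. -/
theorem normExp_logPath_one {N : 𝔸}
    (h : ∀ s ∈ Set.Icc (0 : ℝ) 1, IsUnit (1 + (s : ℂ) • N)) :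
    normExp (logPath N 1) = 1 + N := by
  have hd : ∀ s ∈ Set.Icc (0 : ℝ) 1,
      HasDerivAt (fun u : ℝ => normExp (-logPath N u) * (1 + (u : ℂ) • N)) 0 s := by
    intro s hs
    have h1 := hasDerivAt_normExp_of_commute (hasDerivAt_logPath h hs).neg fun u =>
      (commute_logPath (commute_logPath (Commute.refl N) s).symm u).neg_left.neg_right
    have h2 : HasDerivAt (fun u : ℝ => 1 + (u : ℂ) • N) N s := by
      have := (Complex.ofRealCLM.hasDerivAt (x := s)).smul_const N
      simpa only [Complex.ofRealCLM_apply, Complex.ofReal_one, one_smul] using this.const_add (1 : 𝔸)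
    have h3 := h1.mul h2
    refine HasDerivAt.congr_deriv h3 ?_
    have hcomm : N * (1 + (s : ℂ) • N) = (1 + (s : ℂ) • N) * N := by
      simp [mul_add, add_mul]
    have : logKernel N s * (1 + (s : ℂ) • N) = N := by
      rw [logKernel, mul_assoc, hcomm, ← mul_assoc, Ring.inverse_mul_cancel _ (h s hs), one_mul]
    rw [mul_neg, neg_mul, mul_assoc, this, neg_add_cancel]
  have hconst := constant_of_has_deriv_right_zero
    (fun s hs => (hd s hs).continuousAt.continuousWithinAt)
    (fun s hs => (hd s ⟨hs.1, hs.2.le⟩).hasDerivWithinAt) 1 (by simp)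
  have h0 : logPath N 0 = 0 := by simp [logPath]
  simp only [h0, neg_zero, normExp_zero, Complex.ofReal_zero, zero_smul, add_zero, one_mul,
    Complex.ofReal_one, one_smul] at hconst
  calc normExp (logPath N 1)
      = normExp (logPath N 1) * (normExp (-logPath N 1) * (1 + N)) := by
        rw [hconst, mul_one]
    _ = 1 + N := by
        rw [← mul_assoc, ← normExp_add (Commute.refl _).neg_right,
          add_neg_cancel, normExp_zero, one_mul]

theorem intervalIntegrable_logKernel {N : 𝔸}
    (h : ∀ s ∈ Set.Icc (0 : ℝ) 1, IsUnit (1 + (s : ℂ) • N)) :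
    IntervalIntegrable (logKernel N) MeasureTheory.volume 0 1 := by
  refine ContinuousOn.intervalIntegrable fun u hu => ?_
  rw [Set.uIcc_of_le zero_le_one] at hu
  exact (continuousAt_logKernel (h u hu)).continuousWithinAt

theorem map_logPath {E : Type*} [NormedAddCommGroup E] [NormedSpace ℂ E] [CompleteSpace E]
    [FiniteDimensional ℂ 𝔸] {N : 𝔸} (h : ∀ s ∈ Set.Icc (0 : ℝ) 1, IsUnit (1 + (s : ℂ) • N))
    (Φ : 𝔸 →ₗ[ℂ] E) : Φ (logPath N 1) = ∫ s in (0 : ℝ)..1, Φ (logKernel N s) :=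
  ((LinearMap.toContinuousLinearMap Φ).intervalIntegral_comp_comm
    (intervalIntegrable_logKernel h)).symm

end Banach

/-! ### Existence and uniqueness of the principal matrix logarithm. -/

section MatrixLogarithm

variable {ι : Type*} [Fintype ι] [DecidableEq ι]

open scoped Matrix.Norms.Operator

theorem matrix_exp_eq_normExp (M : Matrix ι ι ℂ) : NormedSpace.exp M = normExp M := by
  with_unfolding_all rfl

/-- Commuting complex matrices have a common eigenvector for each eigenvalue of the first. -/
theorem exists_common_eigenvector {S T : Matrix ι ι ℂ} (h : Commute S T) {μ : ℂ}
    (hμ : μ ∈ spectrum ℂ S) :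
    ∃ ν : ℂ, ∃ w : ι → ℂ, w ≠ 0 ∧ S.mulVec w = μ • w ∧ T.mulVec w = ν • w := by
  have hμ' : Module.End.HasEigenvalue (Matrix.toLin' S) μ := by
    rw [Module.End.hasEigenvalue_iff_mem_spectrum, Matrix.spectrum_toLin']
    exact hμ
  have hmaps : ∀ w ∈ Module.End.eigenspace (Matrix.toLin' S) μ,
      Matrix.toLin' T w ∈ Module.End.eigenspace (Matrix.toLin' S) μ := by
    intro w hw
    rw [Module.End.mem_eigenspace_iff] at hw ⊢
    simp only [Matrix.toLin'_apply] at hw ⊢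
    rw [Matrix.mulVec_mulVec, h.eq, ← Matrix.mulVec_mulVec, hw, Matrix.mulVec_smul]
  have : Nontrivial (Module.End.eigenspace (Matrix.toLin' S) μ) :=
    Submodule.nontrivial_iff_ne_bot.2 hμ'
  obtain ⟨ν, hν⟩ := Module.End.exists_eigenvalue ((Matrix.toLin' T).restrict hmaps)
  obtain ⟨w, hw, hw0⟩ := hν.exists_hasEigenvector
  refine ⟨ν, w, by simpa using hw0, ?_, ?_⟩
  · exact Module.End.mem_eigenspace_iff.1 w.2
  · exact congrArg Subtype.val (Module.End.mem_eigenspace_iff.1 hw)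

theorem mem_spectrum_of_mulVec {S : Matrix ι ι ℂ} {μ : ℂ} {w : ι → ℂ} (hw : w ≠ 0)
    (h : S.mulVec w = μ • w) : μ ∈ spectrum ℂ S := by
  rw [← Matrix.spectrum_toLin', ← Module.End.hasEigenvalue_iff_mem_spectrum]
  exact Module.End.hasEigenvalue_of_hasEigenvector (x := w)
    ⟨Module.End.mem_eigenspace_iff.2 (by simpa using h), hw⟩

/-- The characteristic polynomial splits with all roots zero, so it is a power of `X`; apply
Cayley–Hamilton. -/
theorem isNilpotent_of_spectrum_subset {D : Matrix ι ι ℂ} (h : ∀ μ ∈ spectrum ℂ D, μ = 0) :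
    IsNilpotent D := by
  have hr : D.charpoly.roots = Multiset.replicate (Multiset.card D.charpoly.roots) 0 := by
    refine Multiset.eq_replicate_card.2 fun μ hμ => h μ ?_
    exact Matrix.mem_spectrum_of_isRoot_charpoly (Polynomial.isRoot_of_mem_roots hμ)
  have hX : D.charpoly = Polynomial.X ^ (Multiset.card D.charpoly.roots) := by
    conv_lhs => rw [(IsAlgClosed.splits D.charpoly).eq_prod_roots_of_monic D.charpoly_monic, hr]
    simp
  refine ⟨Multiset.card D.charpoly.roots, ?_⟩
  have := Matrix.aeval_self_charpoly D
  rw [hX] at this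
  simpa using this

/-- Commuting logarithms of the same matrix with spectra in the principal strip agree. -/
theorem IsPrincipalLog.eq_of_commute {X Q L : Matrix ι ι ℂ} (hQ : IsPrincipalLog X Q)
    (hL : IsPrincipalLog X L) (hc : Commute Q L) : Q = L := by
  have := FiniteDimensional.complete ℂ (Matrix ι ι ℂ)
  have hexp : normExp (Q - L) = 1 := by
    have hX : normExp Q = normExp L := by
      rw [← matrix_exp_eq_normExp, ← matrix_exp_eq_normExp, hQ.1, hL.1]
    rw [sub_eq_add_neg, normExp_add hc.neg_right, hX, ← normExp_add (Commute.refl L).neg_right,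
      add_neg_cancel, normExp_zero]
  refine sub_eq_zero.1 (eq_zero_of_isNilpotent_of_normExp_eq_one
    (isNilpotent_of_spectrum_subset fun μ hμ => ?_) hexp)
  -- A common eigenvector writes `μ` as a difference of eigenvalues of `Q` and `L`, so `|Im μ| <
  -- 2π`; as `exp μ = 1`, this forces `μ = 0`.
  obtain ⟨ν, w, hw, h1, h2⟩ :=
    exists_common_eigenvector ((Commute.refl Q).sub_left hc.symm) hμ
  have h3 : L.mulVec w = (ν - μ) • w := by
    rw [Matrix.sub_mulVec, h2] at h1
    rw [sub_smul, ← h1, sub_sub_cancel]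
  have hν := hQ.2 ν (mem_spectrum_of_mulVec hw h2)
  have hνμ := hL.2 _ (mem_spectrum_of_mulVec hw h3)
  have hμ1 := exp_mem_spectrum_normExp hμ
  have : Nonempty ι := by
    by_contra hne
    rw [not_nonempty_iff] at hne
    exact hw (Subsingleton.elim _ _)
  rw [hexp, spectrum.one_eq, Set.mem_singleton_iff, Complex.exp_eq_one_iff] at hμ1
  obtain ⟨k, rfl⟩ := hμ1
  have hpi := Real.pi_pos
  simp only [Complex.sub_im, Complex.mul_im, Complex.intCast_re, Complex.intCast_im,
    Complex.mul_re, Complex.re_ofNat, Complex.im_ofNat, Complex.ofReal_re, Complex.ofReal_im,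
    Complex.I_re, Complex.I_im] at hνμ
  have h4 : (k : ℝ) < 1 := by nlinarith
  have h5 : (-1 : ℝ) < k := by nlinarith
  have h6 : k = 0 := by
    have : k < 1 := by exact_mod_cast h4
    have : -1 < k := by exact_mod_cast h5
    omega
  simp [h6]

theorem mem_slitPlane_of_segment {ν : ℂ} (h : ∀ s ∈ Set.Icc (0 : ℝ) 1, 1 + (s : ℂ) * ν ≠ 0) {s : ℝ}
    (hs : s ∈ Set.Icc (0 : ℝ) 1) : 1 + (s : ℂ) * ν ∈ Complex.slitPlane := by
  by_contra hn
  rw [Complex.mem_slitPlane_iff, not_or, not_lt, not_not] at hn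
  obtain ⟨hre, him⟩ := hn
  simp at hre him
  have hs0 : s ≠ 0 := by rintro rfl; simp at hre; linarith
  have hν : ν.im = 0 := him.resolve_left hs0
  have hspos : 0 < s := lt_of_le_of_ne hs.1 hs0.symm
  have hνre : ν.re ≤ -1 := by nlinarith [hs.2]
  -- Here `ν` is real and at most `-1`, so the segment from `1` to `1 + ν` meets `0` at parameter
  -- `-1/ν`.
  refine h (-ν.re⁻¹) ⟨?_, ?_⟩ ?_
  · exact neg_nonneg.2 (inv_nonpos.2 (by linarith))
  · have := inv_anti₀ (by norm_num : (0 : ℝ) < 1) (by linarith : 1 ≤ -ν.re)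
    rw [inv_neg] at this
    simpa using this
  · have hne : ν.re ≠ 0 := by linarith
    apply Complex.ext <;> simp [hν, hne]

theorem integral_div_one_add {ν : ℂ} (h : ∀ s ∈ Set.Icc (0 : ℝ) 1, 1 + (s : ℂ) * ν ≠ 0) :
    ∫ s in (0 : ℝ)..1, (1 + (s : ℂ) * ν)⁻¹ * ν = Complex.log (1 + ν) := by
  have hu : Set.uIcc (0 : ℝ) 1 = Set.Icc 0 1 := Set.uIcc_of_le zero_le_one
  have hd : ∀ s ∈ Set.uIcc (0 : ℝ) 1,
      HasDerivAt (fun s : ℝ => Complex.log (1 + (s : ℂ) * ν)) ((1 + (s : ℂ) * ν)⁻¹ * ν) s := by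
    intro s hs
    have h2 : HasDerivAt (fun u : ℝ => 1 + (u : ℂ) * ν) ν s := by
      have := (Complex.ofRealCLM.hasDerivAt (x := s)).mul_const ν
      simpa using this.const_add 1
    have := h2.clog_real (mem_slitPlane_of_segment h (hu ▸ hs))
    rwa [div_eq_inv_mul] at this
  rw [intervalIntegral.integral_eq_sub_of_hasDerivAt hd]
  · simp
  · refine ContinuousOn.intervalIntegrable ?_
    refine ContinuousOn.mul (ContinuousOn.inv₀ (by fun_prop) fun s hs => h s (hu ▸ hs)) (by fun_prop)

theorem one_add_mul_ne_zero {N : Matrix ι ι ℂ} {s : ℝ} (h : IsUnit (1 + (s : ℂ) • N)) {ν : ℂ}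
    (hν : ν ∈ spectrum ℂ N) : 1 + (s : ℂ) * ν ≠ 0 := by
  obtain ⟨-, w, hw, hw1, -⟩ := exists_common_eigenvector (Commute.refl N) hν
  intro h0
  have : (1 + (s : ℂ) • N).mulVec w = 0 := by
    rw [Matrix.add_mulVec, Matrix.one_mulVec, Matrix.smul_mulVec, hw1, smul_smul]
    conv_lhs => rw [← one_smul ℂ w]
    rw [smul_smul, mul_one, ← add_smul, h0, zero_smul]
  apply hw
  have hu := (Matrix.isUnit_iff_isUnit_det _).1 h
  rw [← Matrix.one_mulVec w, ← Matrix.nonsing_inv_mul _ hu, ← Matrix.mulVec_mulVec, this,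
    Matrix.mulVec_zero]

theorem spectrum_one_add_subset_slitPlane {N : Matrix ι ι ℂ}
    (h : ∀ s ∈ Set.Icc (0 : ℝ) 1, IsUnit (1 + (s : ℂ) • N)) :
    ∀ μ ∈ spectrum ℂ (1 + N), μ ∈ Complex.slitPlane := by
  intro μ hμ
  have hμ' : μ - 1 ∈ spectrum ℂ N := by
    rw [spectrum.mem_iff] at hμ ⊢
    convert hμ using 2
    rw [map_sub, map_one]
    abel
  have := mem_slitPlane_of_segment (fun s hs => one_add_mul_ne_zero (h s hs) hμ')
    (s := 1) (by simp)
  simpa using this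

theorem logKernel_mulVec {N : Matrix ι ι ℂ} {s : ℝ} (h : IsUnit (1 + (s : ℂ) • N)) {ν : ℂ}
    {w : ι → ℂ} (hw : w ≠ 0) (hν : N.mulVec w = ν • w) :
    (logKernel N s).mulVec w = ((1 + (s : ℂ) * ν)⁻¹ * ν) • w := by
  have h0 := one_add_mul_ne_zero h (mem_spectrum_of_mulVec hw hν)
  have hu := (Matrix.isUnit_iff_isUnit_det _).1 h
  have h1 : (1 + (s : ℂ) • N).mulVec w = (1 + (s : ℂ) * ν) • w := by
    rw [Matrix.add_mulVec, Matrix.one_mulVec, Matrix.smul_mulVec, hν, smul_smul, add_smul, one_smul]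
  have h2 : (1 + (s : ℂ) • N)⁻¹.mulVec w = (1 + (s : ℂ) * ν)⁻¹ • w := by
    have : (1 + (s : ℂ) • N)⁻¹.mulVec ((1 + (s : ℂ) * ν) • w) = w := by
      rw [← h1, Matrix.mulVec_mulVec, Matrix.nonsing_inv_mul _ hu, Matrix.one_mulVec]
    rw [Matrix.mulVec_smul] at this
    rw [eq_inv_smul_iff₀ h0, this]
  rw [logKernel, ← Matrix.nonsing_inv_eq_ringInverse, ← Matrix.mulVec_mulVec, hν,
    Matrix.mulVec_smul, h2, smul_smul, mul_comm]

theorem map_logPath_matrix {E : Type*} [NormedAddCommGroup E] [NormedSpace ℂ E] [CompleteSpace E]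
    {N : Matrix ι ι ℂ} (h : ∀ s ∈ Set.Icc (0 : ℝ) 1, IsUnit (1 + (s : ℂ) • N))
    (Φ : Matrix ι ι ℂ →ₗ[ℂ] E) : Φ (logPath N 1) = ∫ s in (0 : ℝ)..1, Φ (logKernel N s) := by
  have := FiniteDimensional.complete ℂ (Matrix ι ι ℂ)
  exact map_logPath h Φ

theorem logPath_mulVec {N : Matrix ι ι ℂ}
    (h : ∀ s ∈ Set.Icc (0 : ℝ) 1, IsUnit (1 + (s : ℂ) • N)) {ν : ℂ} {w : ι → ℂ} (hw : w ≠ 0)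
    (hν : N.mulVec w = ν • w) : (logPath N 1).mulVec w = Complex.log (1 + ν) • w := by
  have h1 := map_logPath_matrix h ((Matrix.mulVecBilin (m := ι) ℂ ℂ).flip w)
  have h2 : ∀ M : Matrix ι ι ℂ, (Matrix.mulVecBilin ℂ ℂ).flip w M = M.mulVec w := fun M => rfl
  simp only [h2] at h1
  rw [h1, ← integral_div_one_add fun s hs =>
    one_add_mul_ne_zero (h s hs) (mem_spectrum_of_mulVec hw hν), ←
    intervalIntegral.integral_smul_const]
  refine intervalIntegral.integral_congr fun s hs => ?_
  rw [Set.uIcc_of_le zero_le_one] at hs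
  exact logKernel_mulVec (h s hs) hw hν

theorem isPrincipalLog_logPath {N : Matrix ι ι ℂ}
    (h : ∀ s ∈ Set.Icc (0 : ℝ) 1, IsUnit (1 + (s : ℂ) • N)) :
    IsPrincipalLog (1 + N) (logPath N 1) := by
  have := FiniteDimensional.complete ℂ (Matrix ι ι ℂ)
  refine ⟨(matrix_exp_eq_normExp _).trans (normExp_logPath_one h), fun μ hμ => ?_⟩
  -- On an eigenvector shared with `N` the integral acts as the scalar `Complex.log (1 + ν)`, and `1
  -- + ν` lies off the cut.
  obtain ⟨ν, w, hw, h1, h2⟩ :=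
    exists_common_eigenvector (commute_logPath (Commute.refl N) 1).symm hμ
  have h3 := logPath_mulVec h hw h2
  have hμν : μ = Complex.log (1 + ν) := smul_left_injective ℂ hw (h1.symm.trans h3)
  have hs := mem_slitPlane_of_segment
    (fun s hs => one_add_mul_ne_zero (h s hs) (mem_spectrum_of_mulVec hw h2)) (s := 1) (by simp)
  simp only [Complex.ofReal_one, one_mul] at hs
  rw [hμν, Complex.log_im]
  exact ⟨Complex.neg_pi_lt_arg _,
    (Complex.arg_le_pi _).lt_of_ne (Complex.mem_slitPlane_iff_arg.1 hs).1⟩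

theorem IsPrincipalLog.eq_logPath {N Q : Matrix ι ι ℂ}
    (h : ∀ s ∈ Set.Icc (0 : ℝ) 1, IsUnit (1 + (s : ℂ) • N)) (hQ : IsPrincipalLog (1 + N) Q) :
    Q = logPath N 1 := by
  have := FiniteDimensional.complete ℂ (Matrix ι ι ℂ)
  refine hQ.eq_of_commute (isPrincipalLog_logPath h) (commute_logPath ?_ 1)
  -- Any logarithm commutes with its exponential `1 + N`, hence with `N` and with the integral built
  -- from `N`.
  have h1 : Commute Q (1 + N) := by
    rw [← hQ.1]
    exact (Commute.refl Q).exp_right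
  simpa using h1.sub_right (Commute.one_right Q)

theorem principalLog_eq_logPath {N : Matrix ι ι ℂ}
    (h : ∀ s ∈ Set.Icc (0 : ℝ) 1, IsUnit (1 + (s : ℂ) • N)) :
    principalLog (1 + N) = logPath N 1 := by
  have hex : ∃ Q, IsPrincipalLog (1 + N) Q := ⟨_, isPrincipalLog_logPath h⟩
  rw [principalLog, dif_pos hex]
  exact hex.choose_spec.eq_logPath h

theorem existsUnique_isPrincipalLog {N : Matrix ι ι ℂ}
    (h : ∀ s ∈ Set.Icc (0 : ℝ) 1, IsUnit (1 + (s : ℂ) • N)) :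
    ∃! Q, IsPrincipalLog (1 + N) Q :=
  ⟨logPath N 1, isPrincipalLog_logPath h, fun _ hQ => hQ.eq_logPath h⟩

/-- The integral representation `log (1 + N) = ∫₀¹ (1 + s N)⁻¹ N ds`, seen by linear maps. -/
theorem map_principalLog {E : Type*} [NormedAddCommGroup E] [NormedSpace ℂ E] [CompleteSpace E]
    {N : Matrix ι ι ℂ} (h : ∀ s ∈ Set.Icc (0 : ℝ) 1, IsUnit (1 + (s : ℂ) • N))
    (Φ : Matrix ι ι ℂ →ₗ[ℂ] E) :
    Φ (principalLog (1 + N)) = ∫ s in (0 : ℝ)..1, Φ ((1 + (s : ℂ) • N)⁻¹ * N) := by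
  rw [principalLog_eq_logPath h, map_logPath_matrix h]
  simp only [logKernel, Matrix.nonsing_inv_eq_ringInverse]

end MatrixLogarithm

/-! ### The unit circle and the half-angle tangent. -/

theorem wrap_eq_self {θ : ℝ} (h : θ ∈ Set.Ioo (-Real.pi) Real.pi) : wrap θ = θ := by
  rw [wrap, Complex.arg_exp_mul_I, toIocMod_eq_self]
  exact ⟨h.1, by linarith [h.2]⟩

theorem exp_neg_mul_I (θ : ℝ) :
    Complex.exp (((-θ : ℝ) : ℂ) * Complex.I) = (Complex.exp (θ * Complex.I))⁻¹ := by
  rw [← Complex.exp_neg, Complex.ofReal_neg, neg_mul]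

theorem star_exp_mul_I (θ : ℝ) :
    (starRingEnd ℂ) (Complex.exp (θ * Complex.I)) = (Complex.exp (θ * Complex.I))⁻¹ := by
  rw [← Complex.exp_conj, map_mul, Complex.conj_I, Complex.conj_ofReal, mul_neg, Complex.exp_neg]

theorem conjSystem_exp_mul_I {m p : Type*} (G : ℂ → Matrix p m ℂ) (θ : ℝ) :
    conjSystem G (Complex.exp (θ * Complex.I)) =
      (G (Complex.exp (θ * Complex.I))).conjTranspose := by
  rw [conjSystem, star_exp_mul_I, inv_inv]

/-- On the unit circle `e^{jθ} = (j - t) / (t + j)` with `t = tan (θ / 2)`. -/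
theorem exp_mul_I_eq_tan {θ : ℝ} (h : θ ∈ Set.Ioo (-Real.pi) Real.pi) :
    Complex.exp (θ * Complex.I) * ((Real.tan (θ / 2) : ℂ) + Complex.I) =
      Complex.I - (Real.tan (θ / 2) : ℂ) := by
  have hc : (Real.cos (θ / 2) : ℂ) ≠ 0 := by
    exact_mod_cast (Real.cos_pos_of_mem_Ioo ⟨by linarith [h.1], by linarith [h.2]⟩).ne'
  have h1 : Complex.exp (θ * Complex.I) =
      (Real.cos (θ / 2) + Real.sin (θ / 2) * Complex.I) ^ 2 := by
    rw [Complex.ofReal_cos, Complex.ofReal_sin, ← Complex.exp_mul_I, ← Complex.exp_nat_mul]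
    congr 1
    push_cast
    ring
  have h2 : (Real.cos (θ / 2) : ℂ) ^ 2 + (Real.sin (θ / 2) : ℂ) ^ 2 = 1 := by
    exact_mod_cast Real.cos_sq_add_sin_sq (θ / 2)
  rw [h1, Real.tan_eq_sin_div_cos, Complex.ofReal_div]
  field_simp
  generalize (Real.cos (θ / 2) : ℂ) = c at *
  generalize (Real.sin (θ / 2) : ℂ) = s at *
  have hI := Complex.I_sq
  linear_combination (Complex.I * c - s) * h2 +
    (c ^ 2 * s * 2 + s ^ 3 + s ^ 2 * c * Complex.I) * hI

theorem ofReal_add_I_ne_zero (t : ℝ) : (t : ℂ) + Complex.I ≠ 0 := fun h => by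
  simpa using congrArg Complex.im h

/-! ### The pencil `z E_h - A_h` and the transfer function. -/

section Pencil

variable {n m p : Type*}
variable (A : Matrix n n ℝ) (B : Matrix n m ℝ) (C : Matrix p n ℝ)

/-- The pencil `z E_h - A_h`. -/
def augPencil [DecidableEq n] [Fintype p] (z : ℂ) : Matrix (n ⊕ n) (n ⊕ n) ℂ :=
  z • toC (augE A) - toC (augA A C)

theorem augPencil_eq_fromBlocks [Fintype n] [DecidableEq n] [Fintype p] (z : ℂ) : augPencil A C z =
    Matrix.fromBlocks (z • 1 - toC A) 0 (-((toC C).transpose * toC C))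
      (z • (toC A).transpose - 1) := by
  have h : toC (C.transpose * C) = (toC C).transpose * toC C :=
    Matrix.map_mul (f := Complex.ofRealHom)
  have h1 : toC (1 : Matrix n n ℝ) = 1 := Matrix.map_one _ Complex.ofReal_zero Complex.ofReal_one
  have h0 : toC (0 : Matrix n n ℝ) = 0 := Matrix.map_zero _ Complex.ofReal_zero
  have hE : toC (augE A) = Matrix.fromBlocks 1 0 0 (toC A).transpose := by
    rw [augE, toC, Matrix.fromBlocks_map]
    exact congrArg₂ (fun X Y => Matrix.fromBlocks X Y Y (toC A).transpose) h1 h0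
  have hA : toC (augA A C) = Matrix.fromBlocks (toC A) 0 ((toC C).transpose * toC C) 1 := by
    rw [← h, ← h0, ← h1, augA, toC, Matrix.fromBlocks_map]
    rfl
  rw [augPencil, hE, hA, Matrix.fromBlocks_smul]
  ext (i | i) (j | j) <;> simp

theorem Gam_eq_smul_augPencil [DecidableEq n] [Fintype p] {θ : ℝ}
    (h : θ ∈ Set.Ioo (-Real.pi) Real.pi) :
    Gam A C θ = (-((Real.tan (θ / 2) : ℂ) + Complex.I)) •
      augPencil A C (Complex.exp (θ * Complex.I)) := by
  rw [augPencil, smul_sub, smul_smul, neg_mul, mul_comm, exp_mul_I_eq_tan h, Gam]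
  module

theorem conjTranspose_toC {k l : Type*} (M : Matrix k l ℝ) :
    (toC M).conjTranspose = (toC M).transpose := by
  ext i j
  simp [toC]

variable {A}

/-- The lower block is singular exactly when `z⁻¹` is an eigenvalue of `A`; hence the reflected
interval in the hypothesis of the theorem. -/
theorem lowerBlock_eq [DecidableEq n] {z : ℂ} (hz : z ≠ 0) :
    z • (toC A).transpose - 1 = (-z) • (z⁻¹ • 1 - toC A).transpose := by
  rw [Matrix.transpose_sub, Matrix.transpose_smul, Matrix.transpose_one, smul_sub, smul_smul,
    neg_mul, mul_inv_cancel₀ hz]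
  module

theorem isUnit_smul {k : Type*} [Fintype k] [DecidableEq k] {M : Matrix k k ℂ} {c : ℂ}
    (hc : c ≠ 0) (hM : IsUnit M) : IsUnit (c • M) :=
  hM.smul (Units.mk0 c hc)

theorem isUnit_lowerBlock [Fintype n] [DecidableEq n] {z : ℂ} (hz : z ≠ 0)
    (h : IsUnit (z⁻¹ • (1 : Matrix n n ℂ) - toC A)) :
    IsUnit (z • (toC A).transpose - 1) := by
  rw [lowerBlock_eq hz]
  exact isUnit_smul (neg_ne_zero.2 hz) ((Matrix.isUnit_transpose _).2 h)

theorem isUnit_augPencil [Fintype n] [DecidableEq n] [Fintype p] {z : ℂ} (hz : z ≠ 0)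
    (h : IsUnit (z • (1 : Matrix n n ℂ) - toC A))
    (h' : IsUnit (z⁻¹ • (1 : Matrix n n ℂ) - toC A)) : IsUnit (augPencil A C z) := by
  rw [augPencil_eq_fromBlocks, Matrix.isUnit_fromBlocks_zero₁₂]
  exact ⟨h, isUnit_lowerBlock hz h'⟩

/-- `C_h` and `B_h` select the lower left block of the inverse. On the unit circle the inverse of
the lower diagonal block is `-z⁻¹` times the adjoint of `(z I - A)⁻¹`, which supplies the factor
`G*`. -/
theorem augC_mul_inv_augPencil_mul_augB [Fintype n] [DecidableEq n] [Fintype p] {z : ℂ}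
    (hz : (starRingEnd ℂ) z = z⁻¹) (hz0 : z ≠ 0)
    (h : IsUnit (z • (1 : Matrix n n ℂ) - toC A))
    (h' : IsUnit (z⁻¹ • (1 : Matrix n n ℂ) - toC A)) :
    z • (toC (augC B) * (augPencil A C z)⁻¹ * toC (augB B)) =
      (transfer A B C z).conjTranspose * transfer A B C z := by
  have hB : toC (augB B) = Matrix.fromRows (toC B) 0 := by
    ext (i | i) j <;> simp [toC, augB]
  have hC : toC (augC B) = Matrix.fromCols 0 (-(toC B).transpose) := by
    ext i (j | j) <;> simp [toC, augC]
  have hD : (z • (toC A).transpose - 1)⁻¹ =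
      (-z⁻¹) • ((z • (1 : Matrix n n ℂ) - toC A)⁻¹).conjTranspose := by
    rw [lowerBlock_eq hz0, Matrix.conjTranspose_nonsing_inv, Matrix.conjTranspose_sub,
      Matrix.conjTranspose_smul, Matrix.conjTranspose_one, conjTranspose_toC, Matrix.transpose_sub,
      Matrix.transpose_smul, Matrix.transpose_one, ← starRingEnd_apply, hz]
    have hu : IsUnit (z⁻¹ • (1 : Matrix n n ℂ) - (toC A).transpose).det := by
      have := (Matrix.isUnit_iff_isUnit_det _).1 ((Matrix.isUnit_transpose _).2 h')
      rwa [Matrix.transpose_sub, Matrix.transpose_smul, Matrix.transpose_one] at this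
    refine Matrix.inv_eq_left_inv ?_
    rw [smul_mul_smul_comm, Matrix.nonsing_inv_mul _ hu, neg_mul_neg, inv_mul_cancel₀ hz0, one_smul]
  rw [augPencil_eq_fromBlocks, Matrix.inv_fromBlocks_zero₁₂_of_isUnit_iff _ _ _
    (iff_of_true h (isUnit_lowerBlock hz0 h')), hB, hC, hD, Matrix.fromCols_mul_fromBlocks,
    Matrix.fromCols_mul_fromRows]
  simp only [transfer, Matrix.conjTranspose_mul, conjTranspose_toC, Matrix.mul_assoc,
    Matrix.mul_zero, add_zero, Matrix.mul_neg, Matrix.neg_mul, neg_neg, zero_add,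
    Matrix.zero_mul, Matrix.smul_mul, Matrix.mul_smul, smul_neg, neg_smul, smul_smul,
    mul_inv_cancel₀ hz0, one_smul]

theorem augC_mul_augB [Fintype n] : toC (augC B) * toC (augB B) = 0 := by
  have hB : toC (augB B) = Matrix.fromRows (toC B) 0 := by
    ext (i | i) j <;> simp [toC, augB]
  have hC : toC (augC B) = Matrix.fromCols 0 (-(toC B).transpose) := by
    ext i (j | j) <;> simp [toC, augC]
  rw [hB, hC, Matrix.fromCols_mul_fromRows]
  simp

theorem augE_mul_augB [Fintype n] [DecidableEq n] : toC (augE A) * toC (augB B) = toC (augB B) := by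
  have : augE A * augB B = augB B := by
    rw [augE, augB, Matrix.fromBlocks_mul_fromRows]
    simp
  conv_rhs => rw [← this]
  exact (Matrix.map_mul (f := Complex.ofRealHom)).symm

/-- The derivative of `Γ_d` with respect to `tan (θ / 2)`, in terms of the transfer function. -/
theorem augC_mul_inv_Gam_mul_augB [Fintype n] [DecidableEq n] [Fintype p] {θ : ℝ}
    (hθ : θ ∈ Set.Ioo (-Real.pi) Real.pi)
    (h : IsUnit (Complex.exp (θ * Complex.I) • (1 : Matrix n n ℂ) - toC A))
    (h' : IsUnit ((Complex.exp (θ * Complex.I))⁻¹ • (1 : Matrix n n ℂ) - toC A)) :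
    toC (augC B) * ((Gam A C θ)⁻¹ * (toC (augE A) + toC (augA A C))) * toC (augB B) =
      (2 * Complex.I / (1 + (Real.tan (θ / 2) : ℂ) ^ 2)) •
      ((transfer A B C (Complex.exp (θ * Complex.I))).conjTranspose *
        transfer A B C (Complex.exp (θ * Complex.I))) := by
  rw [← augC_mul_inv_augPencil_mul_augB B C (star_exp_mul_I θ) (Complex.exp_ne_zero _) h h']
  have hI := ofReal_add_I_ne_zero (Real.tan (θ / 2))
  have hz := exp_mul_I_eq_tan hθ
  have hP := (Matrix.isUnit_iff_isUnit_det _).1 (isUnit_augPencil C (Complex.exp_ne_zero _) h h')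
  have hΓ := Gam_eq_smul_augPencil A C hθ
  set t : ℂ := (Real.tan (θ / 2) : ℂ) with ht
  set z := Complex.exp (θ * Complex.I)
  have ht1 : 1 + t ^ 2 ≠ 0 := by
    rw [ht]
    exact_mod_cast (by positivity : (1 + Real.tan (θ / 2) ^ 2) ≠ 0)
  -- After multiplication by the inverse pencil, the second term contributes a multiple of `C_h B_h
  -- = 0`; the first simplifies by `E_h B_h = B_h`.
  have hM : toC (augE A) + toC (augA A C) =
      (1 + z) • toC (augE A) - augPencil A C z := by
    rw [augPencil]
    module
  have hinv : (Gam A C θ)⁻¹ = (-(t + Complex.I)⁻¹) • (augPencil A C z)⁻¹ := by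
    refine Matrix.inv_eq_left_inv ?_
    rw [hΓ, smul_mul_smul_comm, Matrix.nonsing_inv_mul _ hP, neg_mul_neg, inv_mul_cancel₀ hI,
      one_smul]
  rw [hM, hinv, Matrix.mul_sub, Matrix.smul_mul _ _ (augPencil A C z),
    Matrix.nonsing_inv_mul _ hP, Matrix.mul_sub, Matrix.sub_mul, Matrix.mul_smul _ _ (1 : Matrix _ _ ℂ),
    Matrix.mul_one, Matrix.smul_mul _ (toC (augC B)), augC_mul_augB, smul_zero, sub_zero,
    smul_mul_smul_comm, Matrix.mul_smul, Matrix.smul_mul, Matrix.mul_assoc, Matrix.mul_assoc,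
    augE_mul_augB, smul_smul, ← Matrix.mul_assoc]
  congr 1
  have hz' : z = (Complex.I - t) / (t + Complex.I) := by
    rw [eq_div_iff hI, hz]
  rw [hz']
  field_simp
  linear_combination (-(2 * Complex.I)) * Complex.I_sq

end Pencil

end FreqTrunc

end

/-! ### The change of variables and the main theorem. -/

open FreqTrunc

/-- Frequency truncated norm, general case. The first four conclusions say that every object in the
final formula is well defined. -/
theorem mainTheorem3 {n m p : Type*} [Fintype n] [DecidableEq n] [Fintype p]
    (A : Matrix n n ℝ) (B : Matrix n m ℝ) (C : Matrix p n ℝ) (θ₁ θ₂ : ℝ)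
    (hθ₁ : θ₁ ∈ Set.Ioo (-Real.pi) Real.pi) (hθ₂ : θ₂ ∈ Set.Ioo (-Real.pi) Real.pi)
    (hA : ∀ φ : ℝ, FreqTrunc.wrap φ ∈ Set.uIcc θ₁ θ₂ ∪ Set.uIcc (-θ₁) (-θ₂) →
      Complex.exp (φ * Complex.I) ∉ spectrum ℂ (FreqTrunc.toC A)) :
    (∀ i k, IntervalIntegrable
      (fun θ : ℝ =>
        (FreqTrunc.conjSystem (FreqTrunc.transfer A B C) (Complex.exp (θ * Complex.I)) *
          FreqTrunc.transfer A B C (Complex.exp (θ * Complex.I))) i k)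
      MeasureTheory.volume θ₁ θ₂) ∧
    IsUnit (FreqTrunc.Gam A C θ₁) ∧
    (∀ μ ∈ spectrum ℂ ((FreqTrunc.Gam A C θ₁)⁻¹ * FreqTrunc.Gam A C θ₂),
      μ ∈ Complex.slitPlane) ∧
    (∃! Q, FreqTrunc.IsPrincipalLog ((FreqTrunc.Gam A C θ₁)⁻¹ * FreqTrunc.Gam A C θ₂) Q) ∧
    FreqTrunc.matInt
      (fun θ : ℝ =>
        FreqTrunc.conjSystem (FreqTrunc.transfer A B C) (Complex.exp (θ * Complex.I)) *
          FreqTrunc.transfer A B C (Complex.exp (θ * Complex.I))) θ₁ θ₂ =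
      (1 / Complex.I) •
        (FreqTrunc.toC (FreqTrunc.augC B) *
          FreqTrunc.principalLog ((FreqTrunc.Gam A C θ₁)⁻¹ * FreqTrunc.Gam A C θ₂) *
          FreqTrunc.toC (FreqTrunc.augB B)) := by
  have hsub : ∀ θ ∈ Set.uIcc θ₁ θ₂, θ ∈ Set.Ioo (-Real.pi) Real.pi := fun θ hθ =>
    ⟨(lt_min hθ₁.1 hθ₂.1).trans_le hθ.1, hθ.2.trans_lt (max_lt hθ₁.2 hθ₂.2)⟩
  have hP : ∀ θ ∈ Set.uIcc θ₁ θ₂,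
      IsUnit (Complex.exp (θ * Complex.I) • (1 : Matrix n n ℂ) - toC A) := by
    intro θ hθ
    have := hA θ (Or.inl (by rwa [wrap_eq_self (hsub θ hθ)]))
    rwa [spectrum.notMem_iff, Algebra.algebraMap_eq_smul_one] at this
  have hP' : ∀ θ ∈ Set.uIcc θ₁ θ₂,
      IsUnit ((Complex.exp (θ * Complex.I))⁻¹ • (1 : Matrix n n ℂ) - toC A) := by
    intro θ hθ
    have hn : -θ ∈ Set.Ioo (-Real.pi) Real.pi :=
      ⟨neg_lt_neg (hsub θ hθ).2, by linarith [(hsub θ hθ).1]⟩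
    have hn' : -θ ∈ Set.uIcc (-θ₁) (-θ₂) := by
      rw [Set.mem_uIcc] at hθ ⊢
      rcases hθ with hθ | hθ
      · exact Or.inr ⟨by linarith, by linarith⟩
      · exact Or.inl ⟨by linarith, by linarith⟩
    have := hA (-θ) (Or.inr (by rwa [wrap_eq_self hn]))
    rwa [spectrum.notMem_iff, Algebra.algebraMap_eq_smul_one, exp_neg_mul_I] at this
  have hΓ : ∀ θ ∈ Set.uIcc θ₁ θ₂, IsUnit (Gam A C θ) := by
    intro θ hθ
    rw [Gam_eq_smul_augPencil A C (hsub θ hθ)]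
    exact isUnit_smul (neg_ne_zero.2 (ofReal_add_I_ne_zero _))
      (isUnit_augPencil C (Complex.exp_ne_zero _) (hP θ hθ) (hP' θ hθ))
  have hΓ₁ := (Matrix.isUnit_iff_isUnit_det _).1 (hΓ θ₁ Set.left_mem_uIcc)
  set t₁ := Real.tan (θ₁ / 2) with ht₁
  set t₂ := Real.tan (θ₂ / 2) with ht₂
  have hfθ : ∀ θ ∈ Set.Ioo (-Real.pi) Real.pi, 2 * Real.arctan (Real.tan (θ / 2)) = θ := by
    intro θ hθ
    rw [Real.arctan_tan (by linarith [hθ.1]) (by linarith [hθ.2])]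
    ring
  -- This angle makes `tan (f s / 2)` affine in `s`, so that `Γ_d (f s)` runs along a straight
  -- segment of matrices.
  let f : ℝ → ℝ := fun s => 2 * Real.arctan (t₁ + s * (t₂ - t₁))
  have hf0 : f 0 = θ₁ := by simp [f, ht₁, hfθ θ₁ hθ₁]
  have hf1 : f 1 = θ₂ := by simp [f, ht₂, hfθ θ₂ hθ₂]
  have htan : ∀ s, Real.tan (f s / 2) = t₁ + s * (t₂ - t₁) := fun s => by simp [f, Real.tan_arctan]
  have hfmem : ∀ s ∈ Set.Icc (0 : ℝ) 1, f s ∈ Set.uIcc θ₁ θ₂ := by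
    intro s hs
    have hmono : Monotone fun t => 2 * Real.arctan t :=
      Real.arctan_mono.const_mul (by norm_num)
    have h1 : t₁ + s * (t₂ - t₁) ∈ Set.uIcc t₁ t₂ := by
      rw [Set.mem_uIcc]
      rcases le_total t₁ t₂ with h | h
      · exact Or.inl ⟨by nlinarith [hs.1], by nlinarith [hs.2]⟩
      · exact Or.inr ⟨by nlinarith [hs.2], by nlinarith [hs.1]⟩
    have h2 := hmono.mapsTo_uIcc h1
    rwa [hfθ θ₁ hθ₁, hfθ θ₂ hθ₂] at h2
  have hfd : ∀ s, HasDerivAt f (2 * ((t₂ - t₁) / (1 + Real.tan (f s / 2) ^ 2))) s := by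
    intro s
    rw [htan]
    have h1 : HasDerivAt (fun s => t₁ + s * (t₂ - t₁)) (t₂ - t₁) s := by
      simpa using ((hasDerivAt_id s).mul_const (t₂ - t₁)).const_add t₁
    refine (h1.arctan.const_mul 2).congr_deriv ?_
    ring
  set X := (Gam A C θ₁)⁻¹ * Gam A C θ₂ with hX
  obtain ⟨N, hN⟩ : ∃ N, X = 1 + N := ⟨X - 1, by abel⟩
  set M := toC (augE A) + toC (augA A C) with hM
  have hΓf : ∀ s : ℝ, Gam A C (f s) = Gam A C θ₁ + ((s * (t₂ - t₁) : ℝ) : ℂ) • M := by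
    intro s
    rw [Gam, htan, Gam, ← ht₁, ← hM]
    push_cast
    module
  have hΓ₂ : Gam A C θ₂ = Gam A C θ₁ + ((t₂ - t₁ : ℝ) : ℂ) • M := by
    have := hΓf 1
    rwa [hf1, one_mul] at this
  have hNM : N = ((t₂ - t₁ : ℝ) : ℂ) • ((Gam A C θ₁)⁻¹ * M) := by
    have : 1 + N = 1 + ((t₂ - t₁ : ℝ) : ℂ) • ((Gam A C θ₁)⁻¹ * M) := by
      rw [← hN, hX, hΓ₂, mul_add, Matrix.nonsing_inv_mul _ hΓ₁, mul_smul_comm]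
    exact add_left_cancel this
  have hseg : ∀ s : ℝ, 1 + (s : ℂ) • N = (Gam A C θ₁)⁻¹ * Gam A C (f s) := by
    intro s
    rw [hΓf, mul_add, Matrix.nonsing_inv_mul _ hΓ₁, mul_smul_comm, hNM, smul_smul]
    push_cast
    rfl
  have hunit : ∀ s ∈ Set.Icc (0 : ℝ) 1, IsUnit (1 + (s : ℂ) • N) := by
    intro s hs
    rw [hseg]
    exact (Matrix.isUnit_nonsing_inv_iff.2 (hΓ θ₁ Set.left_mem_uIcc)).mul (hΓ _ (hfmem s hs))
  have hkernel : ∀ s ∈ Set.Icc (0 : ℝ) 1,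
      (1 + (s : ℂ) • N)⁻¹ * N = ((t₂ - t₁ : ℝ) : ℂ) • ((Gam A C (f s))⁻¹ * M) := by
    intro s hs
    rw [hseg, Matrix.mul_inv_rev,
      Matrix.nonsing_inv_nonsing_inv _ hΓ₁, hNM, mul_smul_comm, mul_assoc, ← mul_assoc (Gam A C θ₁),
      Matrix.mul_nonsing_inv _ hΓ₁, one_mul]
  have hcont : ContinuousOn (fun θ : ℝ => (transfer A B C (Complex.exp (θ * Complex.I))))
      (Set.uIcc θ₁ θ₂) := by
    intro θ hθ
    refine ContinuousAt.continuousWithinAt ?_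
    have h1 : ContinuousAt (fun θ : ℝ =>
        Complex.exp (θ * Complex.I) • (1 : Matrix n n ℂ) - toC A) θ := by fun_prop
    have h2 := continuousAt_matrix_inv (Complex.exp (θ * Complex.I) • (1 : Matrix n n ℂ) - toC A)
      (NormedRing.inverse_continuousAt ((Matrix.isUnit_iff_isUnit_det _).1 (hP θ hθ)).unit)
    have h3 := ContinuousAt.comp (f := fun θ : ℝ =>
        Complex.exp (θ * Complex.I) • (1 : Matrix n n ℂ) - toC A) h2 h1
    have hc : Continuous fun S : Matrix n n ℂ => toC C * S * toC B :=
      (continuous_const.matrix_mul continuous_id).matrix_mul continuous_const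
    exact hc.continuousAt.comp h3
  simp only [conjSystem_exp_mul_I]
  have hcont' : ∀ i k, ContinuousOn (fun θ : ℝ =>
      ((transfer A B C (Complex.exp (θ * Complex.I))).conjTranspose *
        transfer A B C (Complex.exp (θ * Complex.I))) i k) (Set.uIcc θ₁ θ₂) := by
    intro i k
    have hc : Continuous fun S : Matrix p m ℂ => (S.conjTranspose * S) i k :=
      (continuous_id.matrix_conjTranspose.matrix_mul continuous_id).matrix_elem i k
    exact hc.comp_continuousOn hcont
  refine ⟨fun i k => (hcont' i k).intervalIntegrable, hΓ θ₁ Set.left_mem_uIcc, ?_, ?_, ?_⟩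
  · rw [hN]
    exact spectrum_one_add_subset_slitPlane hunit
  · rw [hN]
    exact existsUnique_isPrincipalLog hunit
  · rw [hN]
    ext i k
    -- One entry of the right-hand side as a linear functional of the logarithm, so that it passes
    -- under the integral.
    let Φ : Matrix (n ⊕ n) (n ⊕ n) ℂ →ₗ[ℂ] ℂ :=
      { toFun := fun S => ((1 / Complex.I) • (toC (augC B) * S * toC (augB B))) i k
        map_add' := fun S T => by
          rw [Matrix.mul_add, Matrix.add_mul, smul_add, Matrix.add_apply]
        map_smul' := fun c S => by
          rw [Matrix.mul_smul, Matrix.smul_mul, smul_comm, Matrix.smul_apply, RingHom.id_apply] }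
    have hΦ := map_principalLog hunit Φ
    refine Eq.trans ?_ hΦ.symm
    have hu : Set.uIcc (0 : ℝ) 1 = Set.Icc 0 1 := Set.uIcc_of_le zero_le_one
    have hsubst := intervalIntegral.integral_deriv_smul_comp' (a := 0) (b := 1)
      (f := f) (fun s _ => hfd s) (g := fun θ : ℝ =>
      ((transfer A B C (Complex.exp (θ * Complex.I))).conjTranspose *
        transfer A B C (Complex.exp (θ * Complex.I))) i k) (by
          simp only [htan]
          refine Continuous.continuousOn ?_
          refine continuous_const.mul (continuous_const.div (by fun_prop) fun s => ?_)
          positivity)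
      ((hcont' i k).mono (by rw [hu]; rintro _ ⟨s, hs, rfl⟩; exact hfmem s hs))
    rw [hf0, hf1] at hsubst
    rw [matInt, Matrix.of_apply, ← hsubst]
    refine intervalIntegral.integral_congr fun s hs => ?_
    rw [hu] at hs
    have hs' := hfmem s hs
    have hder := augC_mul_inv_Gam_mul_augB B C (hsub _ hs') (hP _ hs') (hP' _ hs')
    change _ = ((1 / Complex.I) • (toC (augC B) * ((1 + (s : ℂ) • N)⁻¹ * N) * toC (augB B))) i k
    rw [hkernel s hs, Matrix.mul_smul, Matrix.smul_mul, hder, smul_smul, smul_smul,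
      Matrix.smul_apply, smul_eq_mul, Function.comp_apply, Complex.real_smul]
    -- The scalars match: `(1/j) (t₂ - t₁) · 2j / (1 + t²)` is the derivative of `f`.
    congr 1
    push_cast
    field_simp
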